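/- Let $F$ be a field and let $A$ be a finite-dimensional (left) Leibniz algebra over $F$, that is, a finite-dimensional $F$-vector space with a bilinear product satisfying $a(bc) = (ab)c + b(ac)$ for all $a,b,c \in A$. Put $n = \dim_F A$ and suppose that $F$ has at least $n+1$ elements (possibly infinitely many). For $a \in A$ let $L_a \colon A \to A$, $L_a(x) = ax$, and let $E_A(a) = \{x \in A \mid L_a^k(x) = 0 \text{ for some } k \in \mathbb{N}\}$; this is a subalgebra of $A$, and the subalgebras of this form are called the Engel subalgebras of $A$. A subalgebra $U$ of $A$ is called a Cartan subalgebra if it is nilpotent, that is, $U^k = 0$ for some $k \ge 1$, where $U^1 = U$ and $U^{m+1} = U U^m$ is the span of all products $uv$ with $u \in U$, $v \in U^m$, and if it is equal to its normaliser $\{a \in A \mid au \in U \text{ and } ua \in U \text{ for all } u \in U\}$. Let $U$ be a subalgebra of $A$. Then $U$ is a Cartan subalgebra of $A$ if and only if $U$ is minimal, with respect to inclusion, in the set $\{E_A(a) \mid a \in A\}$ of Engel subalgebras of $A$. -/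

import Mathlib

/-- A (left) Leibniz algebra: all left multiplications are derivations. The bilinearity of the
product over the ground field is carried by the usual algebra instances. -/
class IsLeftLeibniz (A : Type*) [Mul A] [Add A] : Prop where
  leibniz : ∀ a b c : A, a * (b * c) = (a * b) * c + b * (a * c)

namespace Leibniz

/-- In the usual notation `A¹ = A`, `Aᵐ⁺¹ = A Aᵐ` (the span of all products), `algPower F A k`
is `Aᵏ⁺¹`. -/
def algPower (F A : Type*) [Field F] [NonUnitalNonAssocRing A] [Module F A]
    [SMulCommClass F A A] [IsScalarTower F A A] : ℕ → Submodule F A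
  | 0 => ⊤
  | k + 1 => Submodule.map₂ (LinearMap.mul F A) ⊤ (algPower F A k)

/-- `A` is nilpotent if some power of `A` is zero. -/
def IsNilpotentAlgebra (F A : Type*) [Field F] [NonUnitalNonAssocRing A] [Module F A]
    [SMulCommClass F A A] [IsScalarTower F A A] : Prop :=
  ∃ k : ℕ, algPower F A k = ⊥

/-- The (two-sided) normaliser of a subalgebra, as a subset. -/
def normaliser {F A : Type*} [Field F] [NonUnitalNonAssocRing A] [Module F A]
    (U : NonUnitalSubalgebra F A) : Set A :=
  {a | ∀ u ∈ U, a * u ∈ U ∧ u * a ∈ U}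

/-- A Cartan subalgebra: a nilpotent subalgebra equal to its normaliser. -/
def IsCartanSubalgebra {F A : Type*} [Field F] [NonUnitalNonAssocRing A] [Module F A]
    [SMulCommClass F A A] [IsScalarTower F A A] (U : NonUnitalSubalgebra F A) : Prop :=
  IsNilpotentAlgebra F U ∧ (U : Set A) = normaliser U

theorem mulLeft_pow_mul_eq_zero (F : Type*) {A : Type*} [Field F] [NonUnitalNonAssocRing A]
    [Module F A] [SMulCommClass F A A] [IsLeftLeibniz A] (a : A) (m n : ℕ) :
    ∀ x y : A, (LinearMap.mulLeft F a ^ m) x = 0 → (LinearMap.mulLeft F a ^ n) y = 0 →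
      (LinearMap.mulLeft F a ^ (m + n)) (x * y) = 0 := by
  induction m generalizing n with
  | zero =>
    intro x y hx _
    have hx' : x = 0 := by simpa using hx
    simp [hx']
  | succ m ihm =>
    induction n with
    | zero =>
      intro x y _ hy
      have hy' : y = 0 := by simpa using hy
      simp [hy']
    | succ n ihn =>
      intro x y hx hy
      have h1 := ihm (n + 1) (a * x) y (by simpa [pow_succ] using hx) hy
      have h2 := ihn x (a * y) hx (by simpa [pow_succ] using hy)
      rw [show m + 1 + (n + 1) = (m + 1 + n) + 1 by ring, pow_succ, Module.End.mul_apply,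
        LinearMap.mulLeft_apply, IsLeftLeibniz.leibniz, map_add, h2,
        show m + 1 + n = m + (n + 1) by ring, h1, add_zero]

/-- The Engel subalgebra `E_A(a)` of all `x` with `L_a ^ k x = 0` for some `k`. -/
def engel (F : Type*) {A : Type*} [Field F] [NonUnitalNonAssocRing A] [Module F A]
    [SMulCommClass F A A] [IsLeftLeibniz A] (a : A) : NonUnitalSubalgebra F A where
  carrier := {x | ∃ k : ℕ, (LinearMap.mulLeft F a ^ k) x = 0}
  zero_mem' := ⟨0, map_zero _⟩
  add_mem' := by
    rintro x y ⟨m, hx⟩ ⟨n, hy⟩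
    refine ⟨m + n, ?_⟩
    rw [map_add, pow_add, Module.End.mul_apply, Module.End.mul_apply, hy, map_zero, add_zero,
      ← Module.End.mul_apply, ← pow_add, add_comm, pow_add, Module.End.mul_apply, hx, map_zero]
  smul_mem' := by
    rintro c x ⟨m, hx⟩
    exact ⟨m, by rw [map_smul, hx, smul_zero]⟩
  mul_mem' := by
    rintro x y ⟨m, hx⟩ ⟨n, hy⟩
    exact ⟨m + n, mulLeft_pow_mul_eq_zero F a m n x y hx hy⟩

/-- `U` is minimal (for inclusion) in the set of all Engel subalgebras. -/
def IsMinimalEngel {F A : Type*} [Field F] [NonUnitalNonAssocRing A] [Module F A]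
    [SMulCommClass F A A] [IsLeftLeibniz A] (U : NonUnitalSubalgebra F A) : Prop :=
  Minimal (fun V : NonUnitalSubalgebra F A => ∃ a : A, V = engel F a) U

end Leibniz

/-! Let `x ∈ U ≤ E = engel F x`, with `E` minimal among the Engel subalgebras of elements of `U`.
For `y ∈ U` the pencil L_x + α L_{y-x} is invertible on A/E for all but few α. For the other α
minimality makes it nilpotent on E, hence it is so for every α, and α = 1 gives `E ≤ engel F y`. So
U acts nilpotently on E, by Engel's theorem. If U = E, then U is nilpotent; it is self-normalising
since `x * z ∈ E` forces `z ∈ E`. If U is Cartan, take x in U with `engel F x` of least dimension: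
were U smaller than E, nilpotency of the action would give an element of E outside U normalising U.
In a Leibniz algebra `a` may lie outside `engel F a`; `exists_mem_engel_engel_eq` repairs this. -/

open Polynomial Module

namespace Leibniz

/-! ### Pencils of endomorphisms -/

section Pencil

variable {F V : Type*} [Field F] [AddCommGroup V] [Module F V]

theorem exists_polynomial_pencil_pow (f h : End F V) (v : V) (k : ℕ) (l : V →ₗ[F] F) :
    ∃ p : F[X], p.natDegree ≤ k ∧ ∀ α, p.eval α = l (((f + α • h) ^ k) v) := by
  induction k generalizing l with
  | zero => exact ⟨C (l v), by simp, by simp⟩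
  | succ k ih =>
    obtain ⟨p, hp, hpe⟩ := ih (l ∘ₗ f)
    obtain ⟨q, hq, hqe⟩ := ih (l ∘ₗ h)
    refine ⟨p + X * q, ?_, fun α => ?_⟩
    · refine natDegree_add_le_of_degree_le (hp.trans k.le_succ) (natDegree_mul_le.trans ?_)
      have := natDegree_X_le (R := F)
      omega
    · rw [pow_succ', Module.End.mul_apply]
      simp [hpe, hqe]

variable [FiniteDimensional F V]

theorem exists_polynomial_pencil_det (f h : End F V) :
    ∃ p : F[X], p.natDegree ≤ finrank F V ∧ ∀ α, p.eval α = LinearMap.det (f + α • h) := by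
  let b := finBasis F V
  refine ⟨(X • (LinearMap.toMatrix b b h).map C + (LinearMap.toMatrix b b f).map C).det,
    (natDegree_det_X_add_C_le _ _).trans (by simp), fun α => ?_⟩
  rw [← LinearMap.det_toMatrix b, ← coe_evalRingHom, RingHom.map_det]
  congr 1
  ext i j
  simp [add_comm, mul_comm α]

theorem pow_finrank_eq_zero_of_forall_exists {f : End F V} (hf : ∀ v, ∃ k : ℕ, (f ^ k) v = 0) :
    f ^ finrank F V = 0 := by
  have h := f.aeval_self_charpoly
  rwa [(LinearMap.charpoly_eq_X_pow_iff f).mpr hf, map_pow, aeval_X] at h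

theorem pencil_pow_eq_zero (f h : End F V) (s : Finset F) (hs : finrank F V < s.card)
    (H : ∀ α ∈ s, ∀ v, ∃ k : ℕ, ((f + α • h) ^ k) v = 0) (α : F) :
    (f + α • h) ^ finrank F V = 0 := by
  ext v
  rw [LinearMap.zero_apply, ← forall_dual_apply_eq_zero_iff F]
  intro l
  obtain ⟨p, hp, hpe⟩ := exists_polynomial_pencil_pow f h v (finrank F V) l
  have : p = 0 := by
    refine eq_zero_of_natDegree_lt_card_of_eval_eq_zero' p s (fun β hβ => ?_) (hp.trans_lt hs)
    rw [hpe, pow_finrank_eq_zero_of_forall_exists (H β hβ)]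
    simp
  rw [← hpe, this, eval_zero]

theorem exists_finset_pencil_det_ne_zero (f h : End F V) (hf : LinearMap.det f ≠ 0) (r : ℕ)
    (hF : ((finrank F V + r : ℕ) : ℕ∞) ≤ ENat.card F) :
    ∃ s : Finset F, r ≤ s.card ∧ ∀ α ∈ s, LinearMap.det (f + α • h) ≠ 0 := by
  classical
  obtain ⟨p, hp, hpe⟩ := exists_polynomial_pencil_det f h
  have hp0 : p ≠ 0 := by
    rintro rfl
    exact hf (by simpa using (hpe 0).symm)
  rw [← Set.encard_univ] at hF
  obtain ⟨t, -, ht⟩ := Set.exists_subset_encard_eq hF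
  have htf : t.Finite := Set.finite_of_encard_eq_coe ht
  have htc : htf.toFinset.card = finrank F V + r := by
    rw [htf.encard_eq_coe_toFinset_card] at ht
    exact_mod_cast ht
  refine ⟨htf.toFinset \ p.roots.toFinset, ?_, fun α hα h0 => ?_⟩
  · have h1 := Finset.le_card_sdiff p.roots.toFinset htf.toFinset
    have h2 := (Multiset.toFinset_card_le p.roots).trans ((card_roots' p).trans hp)
    omega
  · simp only [Finset.mem_sdiff, Multiset.mem_toFinset, mem_roots hp0, IsRoot.def] at hα
    exact hα.2 ((hpe α).trans h0)

/-- Hypothesis `H` abstracts minimality: a null component contained in `E` is all of `E`. -/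
theorem pencil_locally_nilpotent (E : Submodule F V) (f h : End F V)
    (hF : ((finrank F V + 1 : ℕ) : ℕ∞) ≤ ENat.card F)
    (hfE : ∀ z ∈ E, f z ∈ E) (hhE : ∀ z ∈ E, h z ∈ E) (hf : ∀ z, f z ∈ E → z ∈ E)
    (H : ∀ α : F, (∀ z, ∀ k : ℕ, ((f + α • h) ^ k) z = 0 → z ∈ E) →
      ∀ z ∈ E, ∃ k : ℕ, ((f + α • h) ^ k) z = 0)
    (α : F) {z : V} (hz : z ∈ E) : ∃ k : ℕ, ((f + α • h) ^ k) z = 0 := by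
  have hfq : E ≤ E.comap f := hfE
  have hhq : E ≤ E.comap h := hhE
  have hdet : LinearMap.det (E.mapQ E f hfq) ≠ 0 := by
    intro h0
    obtain ⟨q, hq, hq0⟩ := Submodule.exists_mem_ne_zero_of_ne_bot
      (LinearMap.bot_lt_ker_of_det_eq_zero h0).ne'
    obtain ⟨z, rfl⟩ := E.mkQ_surjective q
    refine hq0 ((Submodule.Quotient.mk_eq_zero E).mpr (hf z ?_))
    exact (Submodule.Quotient.mk_eq_zero E).mp hq
  have hfr := E.finrank_quotient_add_finrank
  -- The determinant on V/E has at most dim V/E roots, which leaves dim E + 1 good parameters, one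
  -- more than the degree of the entries of the (dim E)-th power on `E`.
  obtain ⟨s, hs, hsd⟩ := exists_finset_pencil_det_ne_zero (E.mapQ E f hfq) (E.mapQ E h hhq) hdet
    (finrank F E + 1) (by rwa [← add_assoc, hfr])
  have hpow (β : F) (k : ℕ) (w : E) :
      ((((f.restrict hfE + β • h.restrict hhE) ^ k) w : E) : V) = ((f + β • h) ^ k) w := by
    induction k with
    | zero => simp
    | succ k ih => simp [pow_succ', ← ih]
  refine ⟨finrank F E, ?_⟩
  rw [← hpow α _ ⟨z, hz⟩, pencil_pow_eq_zero _ _ s hs]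
  · rfl
  rintro β hβ ⟨w, hw⟩
  suffices hker : ∀ z, ∀ k : ℕ, ((f + β • h) ^ k) z = 0 → z ∈ E by
    obtain ⟨k, hk⟩ := H β hker w hw
    exact ⟨k, Subtype.ext ((hpow _ _ _).trans hk)⟩
  intro z k hk
  induction k generalizing z with
  | zero =>
    have : z = 0 := by simpa using hk
    exact this ▸ E.zero_mem
  | succ k ih =>
    have h1 : (f + β • h) z ∈ E := ih _ (by rwa [pow_succ] at hk)
    have hinj := (LinearMap.isUnit_iff_ker_eq_bot _).mp
      ((LinearMap.isUnit_iff_isUnit_det _).mpr (hsd β hβ).isUnit)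
    rw [← Submodule.Quotient.mk_eq_zero, ← Submodule.mem_bot F, ← hinj]
    exact (Submodule.Quotient.mk_eq_zero E).mpr h1

end Pencil
-- Iterated left products
section Products

variable {F A : Type*} [Field F] [NonUnitalNonAssocRing A] [Module F A]
  [SMulCommClass F A A] [IsScalarTower F A A]

variable (F A) in
/-- The elements `z` with `z * c = 0` for all `c`. -/
def leftAnnihilator : Submodule F A := LinearMap.ker (LinearMap.mul F A)

theorem mem_leftAnnihilator {z : A} : z ∈ leftAnnihilator F A ↔ ∀ c, z * c = 0 := by
  simp [leftAnnihilator, LinearMap.ext_iff]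

/-- The span of all products of an element of `U` with an element of `W`. -/
abbrev leftMul (U : NonUnitalSubalgebra F A) (W : Submodule F A) : Submodule F A :=
  Submodule.map₂ (LinearMap.mul F A) U.toSubmodule W

theorem leftMul_iterate_mono (U : NonUnitalSubalgebra F A) {W W' : Submodule F A} (h : W ≤ W')
    (k : ℕ) : (leftMul U)^[k] W ≤ (leftMul U)^[k] W' :=
  (show Monotone (leftMul U) from fun _ _ h => Submodule.map₂_le_map₂_right h).iterate k h

/-- The iterates of `W` decrease to zero, so take `w` in the last one not inside `U`. -/
theorem exists_mem_notMem_mul_mem {U : NonUnitalSubalgebra F A} {W : Submodule F A}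
    (hUW : ∀ u ∈ U, ∀ w ∈ W, u * w ∈ W) {k : ℕ} (hk : (leftMul U)^[k] W = ⊥)
    (hW : ¬ W ≤ U.toSubmodule) : ∃ w ∈ W, w ∉ U ∧ ∀ u ∈ U, u * w ∈ U := by
  induction k generalizing W with
  | zero =>
    have : W = ⊥ := hk
    simp [this] at hW
  | succ k ih =>
    by_cases h : leftMul U W ≤ U.toSubmodule
    · obtain ⟨w, hw, hwU⟩ := SetLike.not_le_iff_exists.mp hW
      exact ⟨w, hw, hwU, fun u hu => h (Submodule.apply_mem_map₂ _ hu hw)⟩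
    · have hle : leftMul U W ≤ W := Submodule.map₂_le.mpr hUW
      obtain ⟨w, hw, h⟩ := ih (fun u hu w hw => Submodule.apply_mem_map₂ _ hu (hle hw)) hk h
      exact ⟨w, hle hw, h⟩

theorem map_subtype_algPower (U : NonUnitalSubalgebra F A) (k : ℕ) :
    (algPower F U k).map U.toSubmodule.subtype = (leftMul U)^[k] U.toSubmodule := by
  induction k with
  | zero => exact U.toSubmodule.map_subtype_top
  | succ k ih =>
    rw [Function.iterate_succ_apply', ← ih, algPower]
    apply le_antisymm
    · rw [Submodule.map_le_iff_le_comap]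
      refine Submodule.map₂_le.mpr fun u _ v hv => ?_
      exact Submodule.apply_mem_map₂ _ u.2 (Submodule.mem_map_of_mem hv)
    · refine Submodule.map₂_le.mpr ?_
      rintro u hu _ ⟨v, hv, rfl⟩
      exact ⟨(⟨u, hu⟩ : U) * v, Submodule.apply_mem_map₂ (LinearMap.mul F U) Submodule.mem_top hv, rfl⟩

theorem isNilpotentAlgebra_iff (U : NonUnitalSubalgebra F A) :
    IsNilpotentAlgebra F U ↔ ∃ k : ℕ, (leftMul U)^[k] U.toSubmodule = ⊥ := by
  refine exists_congr fun k => ?_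
  rw [← map_subtype_algPower]
  exact ((Submodule.map_injective_of_injective U.toSubmodule.subtype_injective).eq_iff'
    (Submodule.map_bot _)).symm

end Products

/-! ### Engel subalgebras and Engel's theorem -/

section Engel

variable {F A : Type*} [Field F] [NonUnitalNonAssocRing A] [Module F A]
  [SMulCommClass F A A] [IsLeftLeibniz A]

theorem mem_engel {a x : A} : x ∈ engel F a ↔ ∃ k : ℕ, (LinearMap.mulLeft F a ^ k) x = 0 :=
  Iff.rfl

theorem mem_engel_of_mul_mem {a x : A} (h : a * x ∈ engel F a) : x ∈ engel F a := by
  obtain ⟨k, hk⟩ := h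
  exact ⟨k + 1, by rwa [pow_succ]⟩

variable [IsScalarTower F A A]

theorem mul_mul_eq_sub (a b c : A) : (a * b) * c = a * (b * c) - b * (a * c) := by
  rw [IsLeftLeibniz.leibniz a b c, add_sub_cancel_right]

theorem mul_mem_leftAnnihilator (a : A) {z : A} (hz : z ∈ leftAnnihilator F A) :
    a * z ∈ leftAnnihilator F A := by
  rw [mem_leftAnnihilator] at *
  intro c
  rw [mul_mul_eq_sub, hz, hz, mul_zero, sub_zero]

theorem mul_add_mul_mem_leftAnnihilator (a b : A) : a * b + b * a ∈ leftAnnihilator F A := by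
  rw [mem_leftAnnihilator]
  intro c
  rw [add_mul, mul_mul_eq_sub, mul_mul_eq_sub b a]
  abel

theorem mul_self_mem_leftAnnihilator (a : A) : a * a ∈ leftAnnihilator F A := by
  rw [mem_leftAnnihilator]
  intro c
  rw [mul_mul_eq_sub, sub_self]

/-- Subtracting a left annihilator element `k` from `a` leaves L_a unchanged. As `a * a` is in the
left annihilator, where the ranges of powers of L_a stabilise, `k` can be chosen to cancel L_a^N (a
* a). -/
theorem exists_mem_engel_engel_eq [FiniteDimensional F A] (a : A) :
    ∃ b ∈ engel F a, engel F b = engel F a := by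
  let T := (LinearMap.mulLeft F a).restrict (p := leftAnnihilator F A) (q := leftAnnihilator F A)
    fun z hz => mul_mem_leftAnnihilator a hz
  have hT (k : ℕ) (z : leftAnnihilator F A) :
      (((T ^ k) z : leftAnnihilator F A) : A) = (LinearMap.mulLeft F a ^ k) z := by
    induction k with
    | zero => simp
    | succ k ih => rw [pow_succ', pow_succ', End.mul_apply, End.mul_apply, ← ih]; rfl
  obtain ⟨N, hN⟩ := Filter.eventually_atTop.mp T.eventually_iInf_range_pow_eq
  obtain ⟨k, hk⟩ : (T ^ N) ⟨a * a, mul_self_mem_leftAnnihilator a⟩ ∈ LinearMap.range (T ^ (N + 1)) := by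
    rw [← hN (N + 1) N.le_succ, hN N le_rfl]
    exact LinearMap.mem_range_self _ _
  have hL : LinearMap.mulLeft F (a - k) = LinearMap.mulLeft F a := by
    ext c
    simp [sub_mul, mem_leftAnnihilator.mp k.2 c]
  refine ⟨a - k, ⟨N + 1, ?_⟩, ?_⟩
  · rw [map_sub, ← hT, hk, hT, pow_succ, End.mul_apply, LinearMap.mulLeft_apply, sub_self]
  · ext x
    rw [mem_engel, mem_engel, hL]

attribute [local instance] LieRing.ofAssociativeRing

/-- The Lie algebra of left multiplications by elements of `U`. -/
def leftMulLie (U : NonUnitalSubalgebra F A) : LieSubalgebra F (End F A) where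
  __ := U.toSubmodule.map (LinearMap.mul F A)
  lie_mem' := by
    rintro _ _ ⟨u, hu, rfl⟩ ⟨v, hv, rfl⟩
    refine ⟨u * v, U.mul_mem hu hv, ?_⟩
    ext c
    simp [LieRing.of_associative_ring_bracket, mul_mul_eq_sub]

/-- Left multiplications by `U` form a Lie algebra, so Engel's theorem for Lie modules applies to
`E`. -/
theorem exists_leftMul_iterate_eq_bot [FiniteDimensional F A] (U : NonUnitalSubalgebra F A)
    (E : Submodule F A) (hUE : ∀ u ∈ U, ∀ z ∈ E, u * z ∈ E)
    (hE : ∀ u ∈ U, ∀ z ∈ E, z ∈ engel F u) : ∃ k : ℕ, (leftMul U)^[k] E = ⊥ := by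
  let M : LieSubmodule F (leftMulLie U) A :=
    { E with
      lie_mem := by
        rintro ⟨_, u, hu, rfl⟩ z hz
        exact hUE u hu z hz }
  have hnil : LieModule.IsNilpotent (leftMulLie U) M := by
    rw [LieModule.isNilpotent_iff_forall' (R := F)]
    rintro ⟨_, u, hu, rfl⟩
    refine ⟨finrank F M, pow_finrank_eq_zero_of_forall_exists ?_⟩
    rintro ⟨z, hz⟩
    obtain ⟨k, hk⟩ := hE u hu z hz
    refine ⟨k, Subtype.ext ?_⟩
    rw [LieSubmodule.coe_toEnd_pow]
    exact hk
  obtain ⟨k, hk⟩ := (LieModule.isNilpotent_iff F (leftMulLie U) M).mp hnil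
  have key (k : ℕ) : ∀ z ∈ (leftMul U)^[k] E,
      ∃ m ∈ LieModule.lowerCentralSeries F (leftMulLie U) M k, (m : A) = z := by
    induction k with
    | zero => exact fun z hz => ⟨⟨z, hz⟩, by simp, rfl⟩
    | succ k ih =>
      rw [Function.iterate_succ_apply']
      suffices h : leftMul U ((leftMul U)^[k] E) ≤
          (LieModule.lowerCentralSeries F (leftMulLie U) M (k + 1)).toSubmodule.map
            M.toSubmodule.subtype from fun z hz => h hz
      refine Submodule.map₂_le.mpr fun u hu z hz => ?_
      obtain ⟨m, hm, rfl⟩ := ih z hz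
      let u' : leftMulLie U := ⟨LinearMap.mul F A u, u, hu, rfl⟩
      have hmem : ⁅u', m⁆ ∈ LieModule.lowerCentralSeries F (leftMulLie U) M (k + 1) := by
        rw [LieModule.lowerCentralSeries_succ]
        exact LieSubmodule.lie_mem_lie (LieSubmodule.mem_top _) hm
      exact ⟨_, hmem, rfl⟩
  refine ⟨k, (Submodule.eq_bot_iff _).mpr fun z hz => ?_⟩
  obtain ⟨m, hm, rfl⟩ := key k z hz
  rw [hk, LieSubmodule.mem_bot] at hm
  simp [hm]

theorem IsNilpotentAlgebra.le_engel {U : NonUnitalSubalgebra F A} (hU : IsNilpotentAlgebra F U)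
    {u : A} (hu : u ∈ U) : U ≤ engel F u := by
  obtain ⟨k, hk⟩ := (isNilpotentAlgebra_iff U).mp hU
  intro x hx
  have h (m : ℕ) : (LinearMap.mulLeft F u ^ m) x ∈ (leftMul U)^[m] U.toSubmodule := by
    induction m with
    | zero => exact hx
    | succ m ih =>
      rw [Function.iterate_succ_apply', pow_succ']
      exact Submodule.apply_mem_map₂ _ hu ih
  exact ⟨k, by simpa [hk] using h k⟩

/-- If `U ≤ engel F x` and `engel F x` is minimal among the Engel subalgebras of elements
of `U`, then it is the smallest of them. -/
theorem engel_le_engel_of_minimal [FiniteDimensional F A]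
    (hF : ((finrank F A + 1 : ℕ) : ℕ∞) ≤ ENat.card F) {U : NonUnitalSubalgebra F A} {x : A}
    (hx : x ∈ U) (hU : U ≤ engel F x)
    (hmin : ∀ y ∈ U, engel F y ≤ engel F x → engel F x ≤ engel F y) {y : A} (hy : y ∈ U) :
    engel F x ≤ engel F y := by
  have hpencil (α : F) : LinearMap.mulLeft F x + α • LinearMap.mulLeft F (y - x) =
      LinearMap.mulLeft F (x + α • (y - x)) := by
    ext c
    simp [add_mul, smul_mul_assoc]
  intro z hz
  have := pencil_locally_nilpotent (engel F x).toSubmodule (LinearMap.mulLeft F x)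
    (LinearMap.mulLeft F (y - x)) hF
    (fun z hz => (engel F x).mul_mem (hU hx) hz)
    (fun z hz => (engel F x).mul_mem (hU (sub_mem hy hx)) hz)
    (fun z => mem_engel_of_mul_mem)
    (fun α h z hz => by
      rw [hpencil] at h ⊢
      exact hmin _ (add_mem hx (SMulMemClass.smul_mem α (sub_mem hy hx))) (fun w ⟨k, hk⟩ => h w k hk) hz)
    1 hz
  rwa [hpencil, one_smul, add_sub_cancel] at this

end Engel

/-! ### Cartan subalgebras are the minimal Engel subalgebras -/

section Cartan

variable {F A : Type*} [Field F] [NonUnitalNonAssocRing A] [Module F A]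
  [SMulCommClass F A A] [IsScalarTower F A A] [IsLeftLeibniz A] [FiniteDimensional F A]

theorem IsMinimalEngel.isCartanSubalgebra (hF : ((finrank F A + 1 : ℕ) : ℕ∞) ≤ ENat.card F)
    {U : NonUnitalSubalgebra F A} (hU : IsMinimalEngel U) : IsCartanSubalgebra U := by
  obtain ⟨⟨b, rfl⟩, hmin⟩ := hU
  obtain ⟨a, ha, hab⟩ := exists_mem_engel_engel_eq (F := F) b
  rw [← hab] at ha hmin ⊢
  have hle {y : A} (hy : y ∈ engel F a) : engel F a ≤ engel F y :=
    engel_le_engel_of_minimal hF ha le_rfl (fun y _ h => hmin ⟨y, rfl⟩ h) hy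
  refine ⟨(isNilpotentAlgebra_iff _).mpr (exists_leftMul_iterate_eq_bot _ _
    (fun u hu z hz => (engel F a).mul_mem hu hz) fun u hu z hz => hle hu hz), ?_⟩
  ext z
  exact ⟨fun hz u hu => ⟨(engel F a).mul_mem hz hu, (engel F a).mul_mem hu hz⟩,
    fun hz => mem_engel_of_mul_mem (hz a ha).2⟩

theorem IsCartanSubalgebra.eq_of_engel_le {U : NonUnitalSubalgebra F A}
    (hU : IsCartanSubalgebra U) {E : NonUnitalSubalgebra F A} (hUE : U ≤ E)
    (hE : ∀ u ∈ U, E ≤ engel F u) : U = E := by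
  refine hUE.antisymm ?_
  by_contra hEU
  have hUE' : ∀ u ∈ U, ∀ z ∈ E.toSubmodule, u * z ∈ E.toSubmodule :=
    fun u hu z hz => E.mul_mem (hUE hu) hz
  obtain ⟨k, hk⟩ := exists_leftMul_iterate_eq_bot U E.toSubmodule hUE' fun u hu z hz => hE u hu hz
  have hnorm {z : A} (hz : ∀ u ∈ U, z * u ∈ U ∧ u * z ∈ U) : z ∈ U := by
    rw [← SetLike.mem_coe, hU.2]
    exact hz
  -- Left annihilator elements of `E` outside `U` would already enlarge the normaliser.
  have hann : E.toSubmodule ⊓ leftAnnihilator F A ≤ U.toSubmodule := by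
    by_contra hK
    obtain ⟨w, hw, hwU, huw⟩ := exists_mem_notMem_mul_mem
      (W := E.toSubmodule ⊓ leftAnnihilator F A)
      (fun u hu w hw => ⟨hUE' u hu w hw.1, mul_mem_leftAnnihilator u hw.2⟩)
      (le_bot_iff.mp ((leftMul_iterate_mono U inf_le_left k).trans hk.le)) hK
    exact hwU (hnorm fun u hu =>
      ⟨by rw [mem_leftAnnihilator.mp hw.2]; exact U.zero_mem, huw u hu⟩)
  obtain ⟨w, hw, hwU, huw⟩ := exists_mem_notMem_mul_mem hUE' hk hEU
  refine hwU (hnorm fun u hu => ⟨?_, huw u hu⟩)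
  -- Modulo the left annihilator the product is anticommutative, so control of `u * w` gives control
  -- of `w * u`.
  have h : u * w + w * u ∈ U := hann ⟨E.add_mem (E.mul_mem (hUE hu) hw) (E.mul_mem hw (hUE hu)),
    mul_add_mul_mem_leftAnnihilator u w⟩
  simpa using sub_mem h (huw u hu)

theorem IsCartanSubalgebra.isMinimalEngel (hF : ((finrank F A + 1 : ℕ) : ℕ∞) ≤ ENat.card F)
    {U : NonUnitalSubalgebra F A} (hU : IsCartanSubalgebra U) : IsMinimalEngel U := by
  obtain ⟨⟨x, hx⟩, hmin⟩ : ∃ x : U, ∀ y : U,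
      finrank F (engel F (x : A)).toSubmodule ≤ finrank F (engel F (y : A)).toSubmodule :=
    ⟨Function.argmin fun y : U => finrank F (engel F (y : A)).toSubmodule,
      fun y => Function.argmin_le (fun y : U => finrank F (engel F (y : A)).toSubmodule) y⟩
  have hle {y : A} (hy : y ∈ U) : engel F x ≤ engel F y :=
    engel_le_engel_of_minimal hF hx (hU.1.le_engel hx) (fun y hy h =>
      (Submodule.eq_of_le_of_finrank_le (S₁ := (engel F y).toSubmodule)
        (S₂ := (engel F x).toSubmodule) h (hmin ⟨y, hy⟩)).ge) hy
  refine ⟨⟨x, hU.eq_of_engel_le (hU.1.le_engel hx) fun u hu => hle hu⟩, ?_⟩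
  rintro _ ⟨b, rfl⟩ hb
  -- The new generator lies in `engel F b ≤ U`, so nilpotency of `U` applies to it.
  obtain ⟨a, ha, hab⟩ := exists_mem_engel_engel_eq (F := F) b
  rw [← hab]
  exact hU.1.le_engel (hb ha)

end Cartan

end Leibniz

theorem mainTheorem1 {F A : Type*} [Field F] [NonUnitalNonAssocRing A] [Module F A]
    [SMulCommClass F A A] [IsScalarTower F A A] [IsLeftLeibniz A] [FiniteDimensional F A]
    (n : ℕ) (hdim : Module.finrank F A = n) (hF : (n : ℕ∞) + 1 ≤ ENat.card F)
    (U : NonUnitalSubalgebra F A) :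
    Leibniz.IsCartanSubalgebra U ↔ Leibniz.IsMinimalEngel U := by
  subst hdim
  exact ⟨fun h => h.isMinimalEngel (by exact_mod_cast hF),
    fun h => h.isCartanSubalgebra (by exact_mod_cast hF)⟩
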